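/- Let $S$ be a semigroup and let $S^1$ be the monoid obtained from $S$ by adjoining a new identity. For $a,b\in S$ write $a\le_{\mathcal L}b$ if $a\in S^1b$; $a\le_{\mathcal R}b$ if $a\in bS^1$; $a\le_{\mathcal J}b$ if $a\in S^1bS^1$; and $a\le_{\mathcal H}b$ if $a\le_{\mathcal L}b$ and $a\le_{\mathcal R}b$. For $\mathcal K\in\{\mathcal L,\mathcal R,\mathcal J,\mathcal H\}$, $a\,\mathcal K\,b$ means $a\le_{\mathcal K}b$ and $b\le_{\mathcal K}a$; the $\mathcal K$-classes are partially ordered by $\le_{\mathcal K}$, and the height $H_{\mathcal K}(S)\in\mathbb N\cup\{\infty\}$ is the supremum of the sizes of chains of $\mathcal K$-classes. $H_E(S)$ is the supremum of the sizes of chains in the set of idempotents of $S$ ordered by $f\le e\Leftrightarrow ef=fe=f$. $S$ is left stable if ${\le_{\mathcal L}}\cap\mathcal J=\mathcal L$, right stable if ${\le_{\mathcal R}}\cap\mathcal J=\mathcal R$, and stable if it is both. $S$ is regular if for every $a\in S$ there is $b\in S$ with $a=aba$ and $b=bab$. A semigroup is simple if it has exactly one $\mathcal J$-class, and completely simple if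 moreover it has a minimal $\mathcal L$-class and a minimal $\mathcal R$-class. A semigroup $T$ with zero $0$ is 0-simple if $T^2\ne\{0\}$ and its $\mathcal J$-classes are $\{0\}$ and $T\setminus\{0\}$; it is completely 0-simple if moreover it has a 0-minimal $\mathcal L$-class and a 0-minimal $\mathcal R$-class, where a class is 0-minimal if $\{0\}$ is the only class strictly below it. The principal factor of a $\mathcal J$-class $J$ of $S$ is $J$ itself if $J$ is minimal, and otherwise the Rees quotient of $S^1JS^1$ by its ideal $S^1JS^1\setminus J$, that is, $J\cup\{0\}$ with the product of $a,b\in J$ equal to $ab$ if $ab\in J$ and all other products equal to $0$. $S$ is semisimple if each of its principal factors is simple or 0-simple, and completely semisimple if each of them is completely simple or completely 0-simple. The bicyclic monoid is the monoid with presentation $\langle a,b\mid ab=1\rangle$. Then the following are equivalent: (1) $S$ is regular and stable; (2) $S$ is regular and either left stable or right stable; (3) $S$ is completely semisimple; (4) $S$ is semisimple and stable; (5) $S$ is regular and no subsemigroup of $S$ is isomorphic to the bicyclic monoid. Moreover, if any (hence all) of these conditions hold, then $$H_{\mathcal L}(S)=H_{\mathcal R}(S)=H_{\mathcal H}(S)=H_E(S)=H_{\mathcal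 J}(S).$$ -/

import Mathlib

universe u

/-- The four Green's relations that carry a natural preorder. -/
inductive Green where
  | L
  | R
  | J
  | H

namespace Green

/-- Green's preorders on a semigroup `S`; here `WithOne S` is the monoid `S¹` obtained from `S` by
adjoining a new identity. -/
def le {S : Type u} [Semigroup S] : Green → S → S → Prop
  | L, a, b => ∃ s : WithOne S, (a : WithOne S) = s * b
  | R, a, b => ∃ s : WithOne S, (a : WithOne S) = b * s
  | J, a, b => ∃ s t : WithOne S, (a : WithOne S) = s * b * t
  | H, a, b => ∃ s t : WithOne S, (a : WithOne S) = s * b ∧ (a : WithOne S) = b * t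

/-- Green's relation: mutual comparability under Green's preorder. -/
def rel {S : Type u} [Semigroup S] (k : Green) (a b : S) : Prop :=
  k.le a b ∧ k.le b a

theorem le_refl {S : Type u} [Semigroup S] (k : Green) (a : S) : k.le a a := by
  cases k
  · exact ⟨1, by simp⟩
  · exact ⟨1, by simp⟩
  · exact ⟨1, 1, by simp⟩
  · exact ⟨1, 1, by simp, by simp⟩

theorem le_trans {S : Type u} [Semigroup S] (k : Green) {a b c : S}
    (hab : k.le a b) (hbc : k.le b c) : k.le a c := by
  cases k
  · obtain ⟨s, hs⟩ := hab
    obtain ⟨t, ht⟩ := hbc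
    exact ⟨s * t, by rw [hs, ht, mul_assoc]⟩
  · obtain ⟨s, hs⟩ := hab
    obtain ⟨t, ht⟩ := hbc
    exact ⟨t * s, by rw [hs, ht, mul_assoc]⟩
  · obtain ⟨s, s', hs⟩ := hab
    obtain ⟨t, t', ht⟩ := hbc
    exact ⟨s * t, t' * s', by rw [hs, ht]; simp only [mul_assoc]⟩
  · obtain ⟨s, s', hs, hs'⟩ := hab
    obtain ⟨t, t', ht, ht'⟩ := hbc
    exact ⟨s * t, t' * s', by rw [hs, ht, mul_assoc], by rw [hs', ht', mul_assoc]⟩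

/-- Green's relation as a setoid. -/
def setoid (k : Green) (S : Type u) [Semigroup S] : Setoid S where
  r := k.rel
  iseqv :=
    { refl := fun a => ⟨k.le_refl a, k.le_refl a⟩
      symm := fun h => ⟨h.2, h.1⟩
      trans := fun h h' => ⟨k.le_trans h.1 h'.1, k.le_trans h'.2 h.2⟩ }

/-- The set of `k`-classes of `S`, where `k` is one of Green's relations. -/
def Classes (k : Green) (S : Type u) [Semigroup S] : Type u :=
  Quotient (k.setoid S)

/-- The `k`-class of an element. -/
def classOf {S : Type u} [Semigroup S] (k : Green) (a : S) : k.Classes S :=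
  Quotient.mk (k.setoid S) a

/-- The poset of `k`-classes: the class of `a` is below the class of `b` iff `k.le a b`. -/
instance (k : Green) (S : Type u) [Semigroup S] : PartialOrder (k.Classes S) where
  le c d := Quotient.liftOn₂ c d k.le (fun _ _ _ _ ha hb => propext
    ⟨fun h => k.le_trans ha.2 (k.le_trans h hb.1),
      fun h => k.le_trans ha.1 (k.le_trans h hb.2)⟩)
  le_refl c := Quotient.inductionOn c k.le_refl
  le_trans c d e := Quotient.inductionOn₃ c d e fun _ _ _ h h' => k.le_trans h h'
  le_antisymm c d := Quotient.inductionOn₂ c d fun _ _ h h' => Quotient.sound ⟨h, h'⟩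

theorem classOf_le_classOf {S : Type u} [Semigroup S] (k : Green) {a b : S} :
    k.classOf a ≤ k.classOf b ↔ k.le a b :=
  Iff.rfl

theorem classOf_eq_classOf {S : Type u} [Semigroup S] (k : Green) {a b : S} :
    k.classOf a = k.classOf b ↔ k.rel a b := by
  rw [le_antisymm_iff, classOf_le_classOf, classOf_le_classOf, rel]

theorem exists_classOf_eq {S : Type u} [Semigroup S] (k : Green) (c : k.Classes S) :
    ∃ a : S, k.classOf a = c :=
  Quotient.exists_rep c

/-- The `k`-height of `S`: the supremum in `ℕ∞` of the sizes of chains of `k`-classes. -/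
noncomputable def height (k : Green) (S : Type u) [Semigroup S] : ℕ∞ :=
  (Set.univ : Set (k.Classes S)).chainHeight (· ≤ ·)

end Green

/-- The height `H_E(S)` of the poset of idempotents of `S`, where `f ≤ e` iff `e f = f e = f`. -/
noncomputable def idempotentHeight (S : Type u) [Semigroup S] : ℕ∞ :=
  {e : S | IsIdempotentElem e}.chainHeight (fun f e => e * f = f ∧ f * e = f)

/-- `≤_L ∩ J = L`. -/
def IsLeftStable (S : Type u) [Semigroup S] : Prop :=
  ∀ a b : S, (Green.L.le a b ∧ Green.J.rel a b) ↔ Green.L.rel a b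

/-- `≤_R ∩ J = R`. -/
def IsRightStable (S : Type u) [Semigroup S] : Prop :=
  ∀ a b : S, (Green.R.le a b ∧ Green.J.rel a b) ↔ Green.R.rel a b

def IsStable (S : Type u) [Semigroup S] : Prop :=
  IsLeftStable S ∧ IsRightStable S

def IsRegularSemigroup (S : Type u) [Semigroup S] : Prop :=
  ∀ a : S, ∃ b : S, a = a * b * a ∧ b = b * a * b

/-- `S` has exactly one `J`-class. -/
def IsSimpleSemigroup (S : Type u) [Semigroup S] : Prop :=
  Nonempty S ∧ ∀ a b : S, Green.J.rel a b

/-- A simple semigroup with minimal `L`-classes and minimal `R`-classes. -/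
def IsCompletelySimple (S : Type u) [Semigroup S] : Prop :=
  IsSimpleSemigroup S ∧ (∃ c : Green.L.Classes S, IsMin c) ∧ (∃ c : Green.R.Classes S, IsMin c)

def IsZeroElement {S : Type u} [Semigroup S] (z : S) : Prop :=
  ∀ a : S, z * a = z ∧ a * z = z

/-- `S` is 0-simple with zero element `z`: `S² ≠ {z}`, and the `J`-classes of `S` are exactly `{z}`
and its complement. -/
def IsZeroSimpleWith (S : Type u) [Semigroup S] (z : S) : Prop :=
  IsZeroElement z ∧ (∃ a b : S, a * b ≠ z) ∧ ∀ a b : S, Green.J.rel a b ↔ (a = z ↔ b = z)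

def IsZeroSimple (S : Type u) [Semigroup S] : Prop :=
  ∃ z : S, IsZeroSimpleWith S z

/-- A class is 0-minimal if the class of the zero is the only class strictly below it. -/
def IsZeroMinimal {S : Type u} [Semigroup S] (k : Green) (z : S) (c : k.Classes S) : Prop :=
  ∀ d : k.Classes S, d < c ↔ d = k.classOf z

/-- A 0-simple semigroup with 0-minimal `L`-classes and 0-minimal `R`-classes. -/
def IsCompletelyZeroSimple (S : Type u) [Semigroup S] : Prop :=
  ∃ z : S, IsZeroSimpleWith S z ∧
    (∃ c : Green.L.Classes S, IsZeroMinimal Green.L z c) ∧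
    (∃ c : Green.R.Classes S, IsZeroMinimal Green.R z c)

/-- A (two-sided, nonempty) ideal of a semigroup. -/
structure BiIdeal (S : Type u) [Semigroup S] where
  carrier : Set S
  nonempty : carrier.Nonempty
  mul_mem_left : ∀ (s : S) {a : S}, a ∈ carrier → s * a ∈ carrier
  mul_mem_right : ∀ (s : S) {a : S}, a ∈ carrier → a * s ∈ carrier

/-- The underlying set `(S \ I) ∪ {0}` of the Rees quotient of `S` by `I`. -/
inductive ReesQuotient {S : Type u} [Semigroup S] (I : BiIdeal S) : Type u where
  | zero : ReesQuotient I
  | of (a : S) (ha : a ∉ I.carrier) : ReesQuotient I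

namespace ReesQuotient

variable {S : Type u} [Semigroup S] {I : BiIdeal S}

open Classical in
/-- The image in the Rees quotient of an element of `S`: elements of `I` go to zero. -/
noncomputable def mk (I : BiIdeal S) (a : S) : ReesQuotient I :=
  if ha : a ∈ I.carrier then zero else of a ha

/-- The product is that of `S` if both factors and their product lie outside `I`, and is zero
otherwise. -/
noncomputable instance : Mul (ReesQuotient I) where
  mul
    | of a _, of b _ => mk I (a * b)
    | _, _ => zero

theorem mk_of_mem {a : S} (ha : a ∈ I.carrier) : mk I a = zero := dif_pos ha

theorem mk_of_notMem {a : S} (ha : a ∉ I.carrier) : mk I a = of a ha := dif_neg ha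

theorem zero_mul (x : ReesQuotient I) : zero * x = zero := by
  cases x <;> rfl

theorem mul_zero (x : ReesQuotient I) : x * zero = zero := by
  cases x <;> rfl

theorem mk_mul_mk (a b : S) : mk I a * mk I b = mk I (a * b) := by
  by_cases ha : a ∈ I.carrier
  · rw [mk_of_mem ha, mk_of_mem (I.mul_mem_right b ha), zero_mul]
  · by_cases hb : b ∈ I.carrier
    · rw [mk_of_mem hb, mk_of_mem (I.mul_mem_left a hb), mul_zero]
    · rw [mk_of_notMem ha, mk_of_notMem hb]
      rfl

theorem mk_surjective (x : ReesQuotient I) : ∃ a : S, mk I a = x := by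
  cases x with
  | zero =>
    obtain ⟨a, ha⟩ := I.nonempty
    exact ⟨a, mk_of_mem ha⟩
  | of a ha => exact ⟨a, mk_of_notMem ha⟩

noncomputable instance : Semigroup (ReesQuotient I) where
  mul_assoc x y z := by
    obtain ⟨a, rfl⟩ := mk_surjective x
    obtain ⟨b, rfl⟩ := mk_surjective y
    obtain ⟨c, rfl⟩ := mk_surjective z
    simp only [mk_mul_mk, mul_assoc]

end ReesQuotient

section PrincipalFactor

variable {S : Type u} [Semigroup S]

/-- A `J`-class as a subset of `S`. -/
def jClassSet (c : Green.J.Classes S) : Set S :=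
  {x | Green.J.classOf x = c}

theorem classOf_mul_le_left (x y : S) : Green.J.classOf (x * y) ≤ Green.J.classOf x :=
  (Green.classOf_le_classOf _).2 ⟨1, y, by simp⟩

theorem classOf_mul_le_right (x y : S) : Green.J.classOf (x * y) ≤ Green.J.classOf y :=
  (Green.classOf_le_classOf _).2 ⟨x, 1, by simp⟩

/-- A minimal `J`-class, as a subsemigroup. -/
def minimalIdeal (c : Green.J.Classes S) (hc : IsMin c) : Subsemigroup S where
  carrier := jClassSet c
  mul_mem' := by
    intro x y hx _
    have h : Green.J.classOf (x * y) ≤ c := by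
      have hx' : Green.J.classOf x = c := hx
      rw [← hx']
      exact classOf_mul_le_left x y
    exact hc.eq_of_le h

/-- The subset `S¹ J S¹` of `S`. -/
def principalIdealSet (c : Green.J.Classes S) : Set S :=
  {x | ∃ s t : WithOne S, ∃ j ∈ jClassSet c, (x : WithOne S) = s * j * t}

theorem mem_principalIdealSet_iff {c : Green.J.Classes S} {x : S} :
    x ∈ principalIdealSet c ↔ Green.J.classOf x ≤ c := by
  constructor
  · rintro ⟨s, t, j, hj, h⟩
    have hj' : Green.J.classOf j = c := hj
    rw [← hj']
    exact (Green.classOf_le_classOf _).2 ⟨s, t, h⟩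
  · intro h
    obtain ⟨j, hj⟩ := Green.J.exists_classOf_eq c
    rw [← hj, Green.classOf_le_classOf] at h
    obtain ⟨s, t, h⟩ := h
    exact ⟨s, t, j, hj, h⟩

/-- The subsemigroup `S¹ J S¹` of `S`. -/
def principalIdeal (c : Green.J.Classes S) : Subsemigroup S where
  carrier := principalIdealSet c
  mul_mem' := by
    intro x y hx _
    exact mem_principalIdealSet_iff.2
      ((classOf_mul_le_left x y).trans (mem_principalIdealSet_iff.1 hx))

/-- For a non-minimal `J`-class, the ideal `S¹ J S¹ \ J` of the semigroup `S¹ J S¹`. -/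
def belowIdeal (c : Green.J.Classes S) (hc : ¬ IsMin c) : BiIdeal (principalIdeal c) where
  carrier := {x | (x : S) ∉ jClassSet c}
  nonempty := by
    obtain ⟨d, hd⟩ := not_isMin_iff.1 hc
    obtain ⟨x, hx⟩ := Green.J.exists_classOf_eq d
    rw [← hx] at hd
    exact ⟨⟨x, mem_principalIdealSet_iff.2 hd.le⟩, fun h => hd.ne h⟩
  mul_mem_left := by
    intro s a ha h
    have ha1 : Green.J.classOf (a : S) ≤ c := mem_principalIdealSet_iff.1 a.2
    have h1 : Green.J.classOf ((s : S) * (a : S)) = c := h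
    exact ha (le_antisymm ha1 (h1.symm.le.trans (classOf_mul_le_right _ _)))
  mul_mem_right := by
    intro s a ha h
    have ha1 : Green.J.classOf (a : S) ≤ c := mem_principalIdealSet_iff.1 a.2
    have h1 : Green.J.classOf ((a : S) * (s : S)) = c := h
    exact ha (le_antisymm ha1 (h1.symm.le.trans (classOf_mul_le_left _ _)))

open Classical in
/-- The principal factor of a `J`-class `J`: the class itself if it is minimal, and otherwise the
Rees quotient of `S¹ J S¹` by `S¹ J S¹ \ J`. -/
noncomputable def principalFactor (c : Green.J.Classes S) : Semigrp.{u} :=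
  if hc : IsMin c then Semigrp.of (minimalIdeal c hc)
  else Semigrp.of (ReesQuotient (belowIdeal c hc))

end PrincipalFactor

/-- Every principal factor is simple or 0-simple. -/
def IsSemisimpleSemigroup (S : Type u) [Semigroup S] : Prop :=
  ∀ c : Green.J.Classes S,
    IsSimpleSemigroup (principalFactor c) ∨ IsZeroSimple (principalFactor c)

/-- Every principal factor is completely simple or completely 0-simple. -/
def IsCompletelySemisimple (S : Type u) [Semigroup S] : Prop :=
  ∀ c : Green.J.Classes S,
    IsCompletelySimple (principalFactor c) ∨ IsCompletelyZeroSimple (principalFactor c)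

/-- The single defining relation `a b = 1` of the bicyclic monoid, where `a` is the generator
indexed by `true` and `b` the one indexed by `false`. -/
inductive BicyclicRel : FreeMonoid Bool → FreeMonoid Bool → Prop where
  | ab_eq_one : BicyclicRel (FreeMonoid.of true * FreeMonoid.of false) 1

/-- The bicyclic monoid `⟨a, b | a b = 1⟩`. -/
abbrev BicyclicMonoid : Type := PresentedMonoid BicyclicRel

/-- `S` has a subsemigroup isomorphic to the bicyclic monoid. -/
def ContainsBicyclic (S : Type u) [Semigroup S] : Prop :=
  ∃ f : BicyclicMonoid →ₙ* S, Function.Injective f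

/-! In a regular semigroup, failure of stability is visible on idempotents: it yields distinct
`J`-related idempotents `e < f`. Writing `f = s e t`, the elements `x = f s e` and `y = e t f` of
the monoid `fSf` satisfy `x y = f` and `y x ≠ f`, so they generate a bicyclic monoid
(`containsBicyclic_of_idempotents`). Conversely, in a bicyclic subsemigroup `y x` lies strictly
below the identity yet is `J`-related to it, which violates left and right stability at once
(`ContainsBicyclic.not_stable`). Hence one-sided stability already excludes the bicyclic monoid, and
excluding it gives both sides.

For principal factors, the point is that the multipliers witnessing a Green relation inside a
`J`-class `J` can be taken in `J`. Under regularity this identifies `L` and `R` on `J` with those of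
the factor, and stability then makes every nonzero class minimal. Conversely, semisimplicity writes
any element of `J` as `p m q` with `p, q ∈ J` and `m` in a given minimal class, which spreads
minimality over `J` and gives stability. If `S` is semisimple and stable, factor `a = b d` inside
its `J`-class; then `b R a` and `d L a`, so `a ∈ aSa`.

For heights, stability makes the maps from `H`- to `L`- and `R`-classes, and from these to
`J`-classes, strict on chains. Idempotents embed in `H`-classes, and regularity lifts finite chains
of `J`-classes to chains of idempotents, closing the cycle of inequalities. -/

namespace Green

/-! ### Calculus of Green's preorders -/

variable {S : Type u} [Semigroup S] {a b c x y : S}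

theorem L_le_iff : Green.L.le a b ↔ a = b ∨ ∃ s, a = s * b := by
  constructor
  · rintro ⟨s, hs⟩
    cases s with
    | one => exact Or.inl (WithOne.coe_injective (by simpa using hs))
    | coe s => exact Or.inr ⟨s, WithOne.coe_injective (by simpa using hs)⟩
  · rintro (rfl | ⟨s, rfl⟩)
    · exact Green.le_refl _ _
    · exact ⟨s, by simp⟩

theorem R_le_iff : Green.R.le a b ↔ a = b ∨ ∃ s, a = b * s := by
  constructor
  · rintro ⟨s, hs⟩
    cases s with
    | one => exact Or.inl (WithOne.coe_injective (by simpa using hs))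
    | coe s => exact Or.inr ⟨s, WithOne.coe_injective (by simpa using hs)⟩
  · rintro (rfl | ⟨s, rfl⟩)
    · exact Green.le_refl _ _
    · exact ⟨s, by simp⟩

theorem H_le_iff : Green.H.le a b ↔ Green.L.le a b ∧ Green.R.le a b :=
  ⟨fun ⟨s, t, hs, ht⟩ => ⟨⟨s, hs⟩, ⟨t, ht⟩⟩, fun ⟨⟨s, hs⟩, ⟨t, ht⟩⟩ => ⟨s, t, hs, ht⟩⟩

theorem L_le_mul (s b : S) : Green.L.le (s * b) b := L_le_iff.2 (Or.inr ⟨s, rfl⟩)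

theorem R_le_mul (b s : S) : Green.R.le (b * s) b := R_le_iff.2 (Or.inr ⟨s, rfl⟩)

theorem L_le_mul_right (h : Green.L.le a b) (x : S) : Green.L.le (a * x) (b * x) := by
  obtain rfl | ⟨s, rfl⟩ := L_le_iff.1 h
  · exact Green.le_refl _ _
  · exact mul_assoc s b x ▸ L_le_mul _ _

theorem R_le_mul_left (h : Green.R.le a b) (x : S) : Green.R.le (x * a) (x * b) := by
  obtain rfl | ⟨s, rfl⟩ := R_le_iff.1 h
  · exact Green.le_refl _ _
  · exact mul_assoc x b s ▸ R_le_mul _ _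

theorem J_le_of_L (h : Green.L.le a b) : Green.J.le a b :=
  let ⟨s, hs⟩ := h
  ⟨s, 1, by simpa using hs⟩

theorem J_le_of_R (h : Green.R.le a b) : Green.J.le a b :=
  let ⟨s, hs⟩ := h
  ⟨1, s, by simpa using hs⟩

theorem J_le_mul_left (a b : S) : Green.J.le (a * b) a := J_le_of_R (R_le_mul a b)

theorem J_le_mul_right (a b : S) : Green.J.le (a * b) b := J_le_of_L (L_le_mul a b)

theorem exists_L_le_R_le (h : Green.J.le a b) : ∃ m, Green.L.le m b ∧ Green.R.le a m := by
  obtain ⟨s, t, h⟩ := h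
  cases s with
  | one => exact ⟨b, Green.le_refl _ _, t, by simpa using h⟩
  | coe s => exact ⟨s * b, L_le_mul _ _, t, by simpa using h⟩

theorem exists_eq_mul_of_L_le_mul (h : Green.L.le a (b * c)) :
    ∃ b', a = b' * c ∧ Green.L.le b' b := by
  obtain rfl | ⟨s, rfl⟩ := L_le_iff.1 h
  · exact ⟨b, rfl, Green.le_refl _ _⟩
  · exact ⟨s * b, (mul_assoc _ _ _).symm, L_le_mul _ _⟩

theorem exists_eq_mul_of_R_le_mul (h : Green.R.le a (b * c)) :
    ∃ c', a = b * c' ∧ Green.R.le c' c := by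
  obtain rfl | ⟨s, rfl⟩ := R_le_iff.1 h
  · exact ⟨c, rfl, Green.le_refl _ _⟩
  · exact ⟨c * s, mul_assoc _ _ _, R_le_mul _ _⟩

/-- Padding by `x` and `y` absorbs multipliers from `S¹`, so the new ones lie in `S` and stay below
`x` and `y`; this is what later keeps them inside a fixed `J`-class. -/
theorem exists_mul_mul_eq (h : Green.J.le a b) (x y : S) :
    ∃ x' y', Green.R.le x' x ∧ Green.L.le y' y ∧ x * a * y = x' * b * y' := by
  obtain ⟨m, hm, hr⟩ := exists_L_le_R_le h
  have hx : ∃ x', Green.R.le x' x ∧ x * m = x' * b := by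
    obtain rfl | ⟨s, rfl⟩ := L_le_iff.1 hm
    · exact ⟨x, Green.le_refl _ _, rfl⟩
    · exact ⟨x * s, R_le_mul _ _, (mul_assoc _ _ _).symm⟩
  obtain ⟨x', hx', hxm⟩ := hx
  obtain rfl | ⟨t, rfl⟩ := R_le_iff.1 hr
  · exact ⟨x', y, hx', Green.le_refl _ _, by rw [hxm]⟩
  · exact ⟨x', t * y, hx', L_le_mul _ _, by rw [← mul_assoc x, hxm]; simp only [mul_assoc]⟩

theorem rel_refl (k : Green) (a : S) : k.rel a a := ⟨k.le_refl a, k.le_refl a⟩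

theorem J_rel_of_L (h : Green.L.rel a b) : Green.J.rel a b := ⟨J_le_of_L h.1, J_le_of_L h.2⟩

theorem J_rel_of_R (h : Green.R.rel a b) : Green.J.rel a b := ⟨J_le_of_R h.1, J_le_of_R h.2⟩

theorem mul_eq_of_L_le {e : S} (he : IsIdempotentElem e) (h : Green.L.le a e) : a * e = a := by
  obtain rfl | ⟨s, rfl⟩ := L_le_iff.1 h
  · exact he
  · rw [mul_assoc, he]

theorem mul_eq_of_R_le {e : S} (he : IsIdempotentElem e) (h : Green.R.le a e) : e * a = a := by
  obtain rfl | ⟨s, rfl⟩ := R_le_iff.1 h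
  · exact he
  · rw [← mul_assoc, he]

theorem eq_of_H_rel {e f : S} (he : IsIdempotentElem e) (hf : IsIdempotentElem f)
    (h : Green.H.rel e f) : e = f :=
  (mul_eq_of_L_le hf (H_le_iff.1 h.1).1).symm.trans (mul_eq_of_R_le he (H_le_iff.1 h.2).2)

end Green

theorem isLeftStable_iff {S : Type u} [Semigroup S] :
    IsLeftStable S ↔ ∀ a b : S, Green.L.le a b → Green.J.rel a b → Green.L.le b a :=
  ⟨fun h a b hl hj => ((h a b).1 ⟨hl, hj⟩).2, fun h a b =>
    ⟨fun hab => ⟨hab.1, h a b hab.1 hab.2⟩, fun hab => ⟨hab.1, Green.J_rel_of_L hab⟩⟩⟩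

theorem isRightStable_iff {S : Type u} [Semigroup S] :
    IsRightStable S ↔ ∀ a b : S, Green.R.le a b → Green.J.rel a b → Green.R.le b a :=
  ⟨fun h a b hl hj => ((h a b).1 ⟨hl, hj⟩).2, fun h a b =>
    ⟨fun hab => ⟨hab.1, h a b hab.1 hab.2⟩, fun hab => ⟨hab.1, Green.J_rel_of_R hab⟩⟩⟩

/-! ### Idempotents in regular semigroups -/

namespace IsRegularSemigroup

variable {S : Type u} [Semigroup S]

theorem exists_idempotent_L (h : IsRegularSemigroup S) (a : S) :
    ∃ e, IsIdempotentElem e ∧ Green.L.rel a e := by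
  obtain ⟨b, hab, hba⟩ := h a
  refine ⟨b * a, ?_, ?_, Green.L_le_mul _ _⟩
  · rw [IsIdempotentElem, ← mul_assoc, ← hba]
  · exact Green.L_le_iff.2 (Or.inr ⟨a, by rwa [← mul_assoc]⟩)

theorem exists_idempotent_R (h : IsRegularSemigroup S) (a : S) :
    ∃ e, IsIdempotentElem e ∧ Green.R.rel a e := by
  obtain ⟨b, hab, hba⟩ := h a
  refine ⟨a * b, ?_, ?_, Green.R_le_mul _ _⟩
  · rw [IsIdempotentElem, ← mul_assoc, ← hab]
  · exact Green.R_le_iff.2 (Or.inr ⟨a, hab⟩)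

/-- With `b` an inverse of `a` and `a = s e t`, take `f = e t b s e`. It is idempotent because `b (s
e t) b = b`, and it is `J`-related to `a` because `s f t = a b a = a`. -/
theorem exists_idempotent_le (h : IsRegularSemigroup S) {a e : S} (he : IsIdempotentElem e)
    (hae : Green.J.le a e) :
    ∃ f, IsIdempotentElem f ∧ e * f = f ∧ f * e = f ∧ Green.J.rel f a := by
  obtain ⟨b, hab, hba⟩ := h a
  obtain ⟨s, t, -, -, hst⟩ := Green.exists_mul_mul_eq hae (a * b) (b * a)
  have ha : a = s * e * t := by
    rw [← hst, ← mul_assoc, ← hab, ← hab]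
  have hee : ∀ z : S, e * (e * z) = e * z := fun z => by rw [← mul_assoc, he.eq]
  have hb : b * (s * (e * (t * b))) = b := by
    rw [← mul_assoc e t b, ← mul_assoc s, ← mul_assoc s e t, ← ha, ← mul_assoc, ← hba]
  have hb' : ∀ z : S, b * (s * (e * (t * (b * z)))) = b * z := fun z => by
    conv_rhs => rw [← hb]
    simp only [mul_assoc]
  refine ⟨e * t * b * s * e, ?_, ?_, ?_, ?_, ?_⟩
  · simp only [IsIdempotentElem, mul_assoc, hee, hb']
  · simp only [mul_assoc, hee]
  · simp only [mul_assoc, he.eq]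
  · have h1 : Green.J.le (e * t * b * s * e) b := by
      have := Green.J_le_mul_left (b * (s * e)) e
      refine Green.J.le_trans ?_ (Green.J_le_mul_left b (s * e))
      simpa only [mul_assoc] using Green.J_le_mul_right (e * t) (b * (s * e))
    refine Green.J.le_trans h1 ?_
    rw [hba]
    exact Green.J.le_trans (Green.J_le_mul_left _ _) (Green.J_le_mul_right _ _)
  · have h2 : a = s * (e * t * b * s * e) * t := by
      calc a = a * b * a := hab
        _ = (s * e * t) * b * (s * e * t) := by rw [← ha]
        _ = _ := by simp only [mul_assoc]
    conv_lhs => rw [h2]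
    exact Green.J.le_trans (Green.J_le_mul_left _ _) (Green.J_le_mul_right _ _)

end IsRegularSemigroup

/-! ### Comparison of heights -/

section Heights

/-- Any two distinct members of a chain are comparable, so injectivity on comparable pairs makes `f`
injective on every chain. -/
theorem chainHeight_le_chainHeight {α β : Type*} {r : α → α → Prop} {r' : β → β → Prop}
    {s : Set α} {t : Set β} (f : α → β) (hf : Set.MapsTo f s t)
    (hr : ∀ x ∈ s, ∀ y ∈ s, r x y → r' (f x) (f y))
    (hi : ∀ x ∈ s, ∀ y ∈ s, r x y → f x = f y → x = y) :
    s.chainHeight r ≤ t.chainHeight r' := by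
  refine iSup_le fun ⟨w, hw, hc⟩ => ?_
  have hinj : Set.InjOn f w := fun x hx y hy hxy => by
    by_contra hne
    obtain h | h := hc hx hy hne
    · exact hne (hi x (hw hx) y (hw hy) h hxy)
    · exact hne (hi y (hw hy) x (hw hx) h hxy.symm).symm
  change w.encard ≤ _
  rw [← hinj.encard_image]
  refine Set.encard_le_chainHeight_of_isChain _ _ (hf.mono_left hw).image_subset ?_
  rintro _ ⟨x, hx, rfl⟩ _ ⟨y, hy, rfl⟩ hne
  exact (hc hx hy fun h => hne (h ▸ rfl)).imp (hr x (hw hx) y (hw hy)) (hr y (hw hy) x (hw hx))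

namespace Green

variable {S : Type u} [Semigroup S]

theorem height_le_height {k l : Green} (h : ∀ a b : S, k.le a b → l.le a b)
    (h' : ∀ a b : S, k.le a b → l.rel a b → k.le b a) : k.height S ≤ l.height S := by
  refine chainHeight_le_chainHeight
    (Quotient.map' id fun a b hab => ⟨h a b hab.1, h b a hab.2⟩) (fun _ _ => trivial) ?_ ?_
  · intro x _ y _
    induction x, y using Quotient.inductionOn₂ with
    | _ a b => exact h a b
  · intro x _ y _
    induction x, y using Quotient.inductionOn₂ with
    | _ a b =>
      intro hab he
      exact (classOf_eq_classOf k).2 ⟨hab, h' a b hab ((classOf_eq_classOf l).1 he)⟩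

theorem idempotentHeight_le_H : idempotentHeight S ≤ Green.H.height S := by
  refine chainHeight_le_chainHeight (Green.classOf Green.H) (fun _ _ => trivial) ?_ ?_
  · rintro f - e - ⟨h, h'⟩
    exact (classOf_le_classOf _).2 (H_le_iff.2 ⟨h' ▸ L_le_mul f e, h ▸ R_le_mul e f⟩)
  · intro f hf e he _ h
    exact eq_of_H_rel hf he ((classOf_eq_classOf _).1 h)

/-- Descend from the top: pick an idempotent `f ≤ e` in the greatest class of `s`, then recurse
below `f` on the remaining classes. -/
theorem exists_idempotent_chain_le (hS : IsRegularSemigroup S) (s : Finset (Green.J.Classes S))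
    (hs : IsChain (· ≤ ·) (s : Set (Green.J.Classes S))) {e : S} (he : IsIdempotentElem e)
    (hse : ∀ c ∈ s, c ≤ Green.J.classOf e) :
    ∃ w : Set S, (∀ f ∈ w, IsIdempotentElem f ∧ e * f = f ∧ f * e = f) ∧
      IsChain (fun f e => e * f = f ∧ f * e = f) w ∧
      (s : Set (Green.J.Classes S)) ⊆ Green.J.classOf '' w := by
  classical
  induction s using Finset.strongInduction generalizing e with
  | H s ih =>
    obtain rfl | hne := s.eq_empty_or_nonempty
    · exact ⟨∅, by simp, by simp, by simp⟩
    obtain ⟨c, hc⟩ := s.exists_maximal hne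
    obtain ⟨a, rfl⟩ := exists_classOf_eq _ c
    obtain ⟨f, hf, hef, hfe, hfa⟩ :=
      hS.exists_idempotent_le he ((classOf_le_classOf _).1 (hse _ hc.prop))
    have hfa' := (classOf_eq_classOf _).2 hfa
    obtain ⟨w, hw, hwc, hws⟩ := ih (s.erase (Green.J.classOf a)) (Finset.erase_ssubset hc.prop)
      (hs.mono (by simp)) hf (by
        intro d hd
        rw [Finset.mem_erase] at hd
        rw [hfa']
        obtain h | h := hs.total hd.2 hc.prop
        · exact h
        · exact hc.le_of_ge hd.2 h)
    refine ⟨insert f w, ?_, ?_, ?_⟩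
    · rintro g (rfl | hg)
      · exact ⟨hf, hef, hfe⟩
      · obtain ⟨h1, h2, h3⟩ := hw g hg
        exact ⟨h1, by rw [← h2, ← mul_assoc, hef], by rw [← h3, mul_assoc, hfe]⟩
    · exact hwc.insert fun g hg _ => Or.inr (hw g hg).2
    · intro d hd
      by_cases hda : d = Green.J.classOf a
      · exact ⟨f, Set.mem_insert _ _, hfa'.trans hda.symm⟩
      · obtain ⟨g, hg, rfl⟩ := hws (by simpa using ⟨hd, hda⟩)
        exact ⟨g, Set.mem_insert_of_mem _ hg, rfl⟩

theorem J_le_idempotentHeight (hS : IsRegularSemigroup S) :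
    Green.J.height S ≤ idempotentHeight S := by
  -- The height may be infinite, while lifting works for finite chains; hence the comparison through
  -- finite `n`.
  refine ENat.forall_natCast_le_iff_le.mp fun n hn => ?_
  obtain ⟨t, -, htn, htc⟩ := Set.exists_isChain_of_le_chainHeight n hn
  have hfin : t.Finite := Set.finite_of_encard_eq_coe htn
  lift t to Finset (Green.J.Classes S) using hfin
  obtain rfl | hne := t.eq_empty_or_nonempty
  · rw [← htn]; simp
  obtain ⟨c, hc⟩ := t.exists_maximal hne
  obtain ⟨a, rfl⟩ := exists_classOf_eq _ c
  obtain ⟨e, he, hae⟩ := hS.exists_idempotent_L a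
  obtain ⟨w, hw, hwc, hws⟩ := exists_idempotent_chain_le hS t htc he (by
    intro d hd
    rw [← (classOf_eq_classOf Green.J).2 (J_rel_of_L hae)]
    exact (htc.total hd hc.prop).elim id (hc.le_of_ge hd))
  rw [← htn]
  exact ((Set.encard_le_encard hws).trans (Set.encard_image_le _ _)).trans
    (Set.encard_le_chainHeight_of_isChain _ _ (fun f hf => (hw f hf).1) hwc)

theorem heights_eq (hS : IsRegularSemigroup S) (hst : IsStable S) :
    Green.L.height S = Green.R.height S ∧ Green.R.height S = Green.H.height S ∧
      Green.H.height S = idempotentHeight S ∧ idempotentHeight S = Green.J.height S := by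
  have hl := isLeftStable_iff.1 hst.1
  have hr := isRightStable_iff.1 hst.2
  have hHL : Green.H.height S ≤ Green.L.height S :=
    height_le_height (fun a b h => (H_le_iff.1 h).1) fun a b h h' =>
      -- `L`-related elements are `J`-related, so right stability reverses the `R`-comparison.
      H_le_iff.2 ⟨h'.2, hr a b (H_le_iff.1 h).2 (J_rel_of_L h')⟩
  have hHR : Green.H.height S ≤ Green.R.height S :=
    height_le_height (fun a b h => (H_le_iff.1 h).2) fun a b h h' =>
      H_le_iff.2 ⟨hl a b (H_le_iff.1 h).1 (J_rel_of_R h'), h'.2⟩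
  have hLJ : Green.L.height S ≤ Green.J.height S := height_le_height (fun _ _ => J_le_of_L) hl
  have hRJ : Green.R.height S ≤ Green.J.height S := height_le_height (fun _ _ => J_le_of_R) hr
  have hJE := J_le_idempotentHeight hS
  have hEH := idempotentHeight_le_H (S := S)
  have hE := hJE.antisymm (hEH.trans (hHL.trans hLJ))
  have hH := (hHL.trans hLJ).antisymm (hE.le.trans hEH)
  have hL := hLJ.antisymm (hH.symm.le.trans hHL)
  have hR := hRJ.antisymm (hH.symm.le.trans hHR)
  exact ⟨hL.trans hR.symm, hR.trans hH.symm, hH.trans hE, hE.symm⟩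

end Green

end Heights

/-! ### Bicyclic subsemigroups and stability -/

section Bicyclic

/-- The local monoid `eSe` of an idempotent `e`. -/
def LocalMonoid {S : Type u} [Semigroup S] {e : S} (_ : IsIdempotentElem e) : Type u :=
  {x : S // e * x = x ∧ x * e = x}

instance {S : Type u} [Semigroup S] {e : S} (he : IsIdempotentElem e) :
    Monoid (LocalMonoid he) where
  mul x y := ⟨x.1 * y.1, by rw [← mul_assoc, x.2.1], by rw [mul_assoc, y.2.2]⟩
  mul_assoc x y z := Subtype.ext (mul_assoc x.1 y.1 z.1)
  one := ⟨e, he, he⟩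
  one_mul x := Subtype.ext x.2.1
  mul_one x := Subtype.ext x.2.2

/-- The inclusion of a local monoid, as a homomorphism of semigroups. -/
def LocalMonoid.val {S : Type u} [Semigroup S] {e : S} (he : IsIdempotentElem e) :
    LocalMonoid he →ₙ* S where
  toFun x := x.1
  map_mul' _ _ := rfl

namespace BicyclicMonoid

/-- The generator `a` of the bicyclic monoid. -/
def genA : BicyclicMonoid := PresentedMonoid.of BicyclicRel true

/-- The generator `b` of the bicyclic monoid. -/
def genB : BicyclicMonoid := PresentedMonoid.of BicyclicRel false

theorem genA_mul_genB : genA * genB = 1 :=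
  PresentedMonoid.mk_eq_mk_of_rel BicyclicRel.ab_eq_one

theorem pow_mul_pow_eq_one {M : Type*} [Monoid M] {x y : M} (h : x * y = 1) (n : ℕ) :
    x ^ n * y ^ n = 1 := by
  induction n with
  | zero => simp
  | succ n ih => rw [pow_succ, pow_succ', mul_assoc, ← mul_assoc x, h, one_mul, ih]

/-- The words `b^m a^n` contain `1` and are closed under left multiplication by either generator. -/
theorem exists_eq_pow_mul_pow (q : BicyclicMonoid) : ∃ m n : ℕ, q = genB ^ m * genA ^ n := by
  induction q using PresentedMonoid.inductionOn with
  | _ w =>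
    induction w using FreeMonoid.inductionOn' with
    | one => exact ⟨0, 0, by simp⟩
    | of_mul i w ih =>
      obtain ⟨m, n, h⟩ := ih
      rw [map_mul, h]
      cases i with
      | false => exact ⟨m + 1, n, by rw [pow_succ', mul_assoc]; rfl⟩
      | true =>
        change ∃ m' n', genA * (genB ^ m * genA ^ n) = _
        cases m with
        | zero => exact ⟨0, n + 1, by simp [pow_succ']⟩
        | succ m =>
          refine ⟨m, n, ?_⟩
          rw [pow_succ', mul_assoc, ← mul_assoc genA, genA_mul_genB, one_mul]

section lift

variable {M : Type u} [Monoid M] {x y : M}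

/-- The homomorphism from the bicyclic monoid given by a right invertible element and one of its
right inverses. -/
def lift (h : x * y = 1) : BicyclicMonoid →* M :=
  PresentedMonoid.lift (fun i : Bool => if i then x else y) (by
    rintro _ _ ⟨⟩
    simpa using h)

theorem lift_genA (h : x * y = 1) : lift h genA = x := rfl

theorem lift_genB (h : x * y = 1) : lift h genB = y := rfl

/-- If `j > 0`, then `x` has a left inverse, which must equal its right inverse `y`, so `y x = 1`.
Once `j = 0`, `i > 0` gives `y` a right inverse, with the same outcome. -/
theorem eq_zero_of_pow_mul_pow_eq_one (h : x * y = 1) (h' : y * x ≠ 1) {i j : ℕ}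
    (hij : y ^ i * x ^ j = 1) : i = 0 ∧ j = 0 := by
  have hj : j = 0 := by
    by_contra hj
    obtain ⟨j, rfl⟩ := Nat.exists_eq_succ_of_ne_zero hj
    rw [Nat.succ_eq_add_one, pow_succ, ← mul_assoc] at hij
    rw [left_inv_eq_right_inv hij h] at hij
    exact h' hij
  subst hj
  refine ⟨?_, rfl⟩
  by_contra hi
  obtain ⟨i, rfl⟩ := Nat.exists_eq_succ_of_ne_zero hi
  rw [Nat.succ_eq_add_one, pow_zero, mul_one, pow_succ'] at hij
  rw [← left_inv_eq_right_inv h hij] at hij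
  exact h' hij

/-- Powers of `y` cancel on the left and powers of `x` on the right, which reduces to the case where
one side is `1`. -/
theorem eq_of_pow_mul_pow_eq (h : x * y = 1) (h' : y * x ≠ 1) {m n k l : ℕ} (hmk : m ≤ k)
    (he : y ^ m * x ^ n = y ^ k * x ^ l) : m = k ∧ n = l := by
  obtain ⟨d, rfl⟩ := Nat.exists_eq_add_of_le hmk
  have h1 : x ^ n = y ^ d * x ^ l := by
    have := congrArg (x ^ m * ·) he
    simpa only [pow_add, ← mul_assoc, pow_mul_pow_eq_one h, one_mul] using this
  obtain hnl | hnl := le_total n l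
  · obtain ⟨p, rfl⟩ := Nat.exists_eq_add_of_le' hnl
    have h2 := congrArg (· * y ^ n) h1
    simp only [pow_add, mul_assoc, pow_mul_pow_eq_one h, mul_one] at h2
    have := eq_zero_of_pow_mul_pow_eq_one h h' h2.symm
    omega
  · obtain ⟨p, rfl⟩ := Nat.exists_eq_add_of_le' hnl
    have h2 := congrArg (· * y ^ l) h1
    simp only [pow_add, mul_assoc, pow_mul_pow_eq_one h, mul_one] at h2
    have h3 := congrArg (· * y ^ p) h2
    simp only [pow_mul_pow_eq_one h, ← pow_add] at h3
    have := eq_zero_of_pow_mul_pow_eq_one h h' (i := d + p) (j := 0) (by simp [← h3])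
    omega

theorem lift_injective (h : x * y = 1) (h' : y * x ≠ 1) : Function.Injective (lift h) := by
  intro q r hqr
  obtain ⟨m, n, rfl⟩ := exists_eq_pow_mul_pow q
  obtain ⟨k, l, rfl⟩ := exists_eq_pow_mul_pow r
  simp only [map_mul, map_pow, lift_genA, lift_genB] at hqr
  obtain hmk | hmk := le_total m k
  · obtain ⟨rfl, rfl⟩ := eq_of_pow_mul_pow_eq h h' hmk hqr
    rfl
  · obtain ⟨rfl, rfl⟩ := eq_of_pow_mul_pow_eq h h' hmk hqr.symm
    rfl

end lift

theorem genB_mul_genA_ne_one : genB * genA ≠ 1 := by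
  intro h
  -- Truncated predecessor is a one-sided inverse of successor: the reverse composite sends `0` to
  -- `1`.
  have hx : (show Function.End ℕ from Nat.pred) * (show Function.End ℕ from Nat.succ) = 1 := rfl
  have h1 := congrArg (lift hx) h
  rw [map_mul, lift_genA, lift_genB, map_one] at h1
  exact absurd (congrFun h1 0) Nat.one_ne_zero

end BicyclicMonoid

variable {S : Type u} [Semigroup S]

/-- The elements `f s e` and `e t f`, where `f = s e t`, multiply to `f` in one order. In the other
order the product is fixed by `e` on the left, so if it were `f`, then `e = e f = f`. -/
theorem containsBicyclic_of_idempotents {e f : S} (he : IsIdempotentElem e)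
    (hf : IsIdempotentElem f) (hfe : f * e = e) (hef : e * f = e) (hJ : Green.J.le f e)
    (hne : e ≠ f) : ContainsBicyclic S := by
  obtain ⟨s, t, -, -, hst⟩ := Green.exists_mul_mul_eq hJ f f
  rw [hf.eq, hf.eq] at hst
  have hee : ∀ z : S, e * (e * z) = e * z := fun z => by rw [← mul_assoc, he.eq]
  have hff : ∀ z : S, f * (f * z) = f * z := fun z => by rw [← mul_assoc, hf.eq]
  have hfe' : ∀ z : S, f * (e * z) = e * z := fun z => by rw [← mul_assoc, hfe]
  let x : LocalMonoid hf := ⟨f * s * e, by simp only [mul_assoc, hff], by rw [mul_assoc, hef]⟩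
  let y : LocalMonoid hf :=
    ⟨e * t * f, by simp only [mul_assoc, hfe'], by simp only [mul_assoc, hf.eq]⟩
  have hxy : x * y = 1 := Subtype.ext <| by
    change f * s * e * (e * t * f) = f
    calc f * s * e * (e * t * f) = f * (s * e * t) * f := by simp only [mul_assoc, hee]
      _ = f := by rw [← hst, hf.eq, hf.eq]
  have hyx : y * x ≠ 1 := fun h => hne <| by
    have h1 : e * t * f * (f * s * e) = f := congrArg Subtype.val h
    calc e = e * f := hef.symm
      _ = e * (e * t * f * (f * s * e)) := by rw [h1]
      _ = e * t * f * (f * s * e) := by simp only [mul_assoc, hee]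
      _ = f := h1
  refine ⟨(LocalMonoid.val hf).comp (BicyclicMonoid.lift hxy : BicyclicMonoid →ₙ* _), ?_⟩
  exact Subtype.val_injective.comp (BicyclicMonoid.lift_injective hxy hyx)

/-- Replace `a ≤ b` by `L`-related idempotents with `e f = e`. As `e` need not lie below `f` on both
sides, use `f e`: an idempotent `L`-related to `e` with `f e ≤ f`, and equal to `f` only if `b ≤ a`.
-/
theorem IsRegularSemigroup.isLeftStable (h : IsRegularSemigroup S) (hB : ¬ ContainsBicyclic S) :
    IsLeftStable S := by
  refine isLeftStable_iff.2 fun a b hab hJ => ?_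
  obtain ⟨e, he, hae⟩ := h.exists_idempotent_L a
  obtain ⟨f, hf, hbf⟩ := h.exists_idempotent_L b
  have hef : e * f = e :=
    Green.mul_eq_of_L_le hf (Green.L.le_trans hae.2 (Green.L.le_trans hab hbf.1))
  have hg : Green.L.rel (f * e) e :=
    ⟨Green.L_le_mul _ _, Green.L_le_iff.2 (Or.inr ⟨e, by rw [← mul_assoc, hef, he.eq]⟩)⟩
  have hfeJ : Green.J.le f (f * e) :=
    Green.J.le_trans (Green.J_le_of_L hbf.2) (Green.J.le_trans hJ.2
      (Green.J_le_of_L (Green.L.le_trans hae.1 hg.2)))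
  by_contra hba
  refine hB (containsBicyclic_of_idempotents (e := f * e) (f := f) ?_ hf ?_ ?_ hfeJ ?_)
  · rw [IsIdempotentElem, mul_assoc, ← mul_assoc e, hef, he.eq]
  · rw [← mul_assoc, hf.eq]
  · rw [mul_assoc, hef]
  · intro h1
    rw [h1] at hg
    exact hba (Green.L.le_trans hbf.1 (Green.L.le_trans hg.1 hae.2))

theorem IsRegularSemigroup.isRightStable (h : IsRegularSemigroup S) (hB : ¬ ContainsBicyclic S) :
    IsRightStable S := by
  refine isRightStable_iff.2 fun a b hab hJ => ?_
  obtain ⟨e, he, hae⟩ := h.exists_idempotent_R a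
  obtain ⟨f, hf, hbf⟩ := h.exists_idempotent_R b
  have hfe : f * e = e :=
    Green.mul_eq_of_R_le hf (Green.R.le_trans hae.2 (Green.R.le_trans hab hbf.1))
  have hg : Green.R.rel (e * f) e :=
    ⟨Green.R_le_mul _ _, Green.R_le_iff.2 (Or.inr ⟨e, by rw [mul_assoc, hfe, he.eq]⟩)⟩
  have hefJ : Green.J.le f (e * f) :=
    Green.J.le_trans (Green.J_le_of_R hbf.2) (Green.J.le_trans hJ.2
      (Green.J_le_of_R (Green.R.le_trans hae.1 hg.2)))
  by_contra hba
  refine hB (containsBicyclic_of_idempotents (e := e * f) (f := f) ?_ hf ?_ ?_ hefJ ?_)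
  · rw [IsIdempotentElem, mul_assoc, ← mul_assoc f, hfe, ← mul_assoc, he.eq]
  · rw [← mul_assoc, hfe]
  · rw [mul_assoc, hf.eq]
  · intro h1
    rw [h1] at hg
    exact hba (Green.R.le_trans hbf.1 (Green.R.le_trans hg.1 hae.2))

/-- The idempotent `y x` lies below `e = x y` on both sides, and `e = x (y x) y` makes them
`J`-related; stability on either side would force `y x = e`. -/
theorem ContainsBicyclic.not_stable (h : ContainsBicyclic S) :
    ¬ (IsLeftStable S ∨ IsRightStable S) := by
  obtain ⟨φ, hφ⟩ := h
  set x := φ BicyclicMonoid.genA with hx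
  set y := φ BicyclicMonoid.genB with hy
  set e := φ 1 with he
  have hxy : x * y = e := by rw [hx, hy, ← map_mul, BicyclicMonoid.genA_mul_genB]
  have hyx : y * x ≠ e := by
    rw [hx, hy, ← map_mul]
    exact fun h => BicyclicMonoid.genB_mul_genA_ne_one (hφ h)
  have hxe : x * e = x := by rw [hx, he, ← map_mul, mul_one]
  have hex : e * x = x := by rw [hx, he, ← map_mul, one_mul]
  have hye : y * e = y := by rw [hy, he, ← map_mul, mul_one]
  have hey : e * y = y := by rw [hy, he, ← map_mul, one_mul]
  have hee : IsIdempotentElem e := by rw [IsIdempotentElem, he, ← map_mul, one_mul]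
  have hidem : IsIdempotentElem (y * x) := by
    rw [IsIdempotentElem, mul_assoc, ← mul_assoc x, hxy, hex]
  have hJ : Green.J.rel (y * x) e := by
    constructor
    · have : y * x = y * x * e := by rw [mul_assoc, hxe]
      rw [this]
      exact Green.J_le_mul_right _ _
    · have : e = x * (y * x) * y := by rw [mul_assoc, mul_assoc, hxy, hye, hxy]
      conv_lhs => rw [this]
      exact Green.J.le_trans (Green.J_le_mul_left _ _) (Green.J_le_mul_right _ _)
  rintro (h | h)
  · have h1 := isLeftStable_iff.1 h (y * x) e
      (Green.L_le_iff.2 (Or.inr ⟨y * x, by rw [mul_assoc, hxe]⟩)) hJ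
    have h2 := Green.mul_eq_of_L_le hidem h1
    rw [← mul_assoc, hey] at h2
    exact hyx h2
  · have h1 := isRightStable_iff.1 h (y * x) e
      (Green.R_le_iff.2 (Or.inr ⟨y * x, by rw [← mul_assoc, hey]⟩)) hJ
    have h2 := Green.mul_eq_of_R_le hidem h1
    rw [mul_assoc, hxe] at h2
    exact hyx h2

end Bicyclic

/-! ### Principal factors in terms of their `J`-class -/

section PrincipalFactors

variable {S : Type u} [Semigroup S] {c : Green.J.Classes S}

theorem rel_of_mem_jClassSet {x y : S} (hx : x ∈ jClassSet c) (hy : y ∈ jClassSet c) :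
    Green.J.rel x y :=
  (Green.classOf_eq_classOf _).1 (Eq.trans hx (Eq.symm hy))

theorem mem_jClassSet_of_le {x y z : S} (hx : x ∈ jClassSet c) (hz : z ∈ jClassSet c)
    (hxy : Green.J.le x y) (hyz : Green.J.le y z) : y ∈ jClassSet c :=
  le_antisymm (((Green.classOf_le_classOf _).2 hyz).trans_eq hz)
    ((Eq.symm hx).trans_le ((Green.classOf_le_classOf _).2 hxy))

section Minimal

variable {hc : IsMin c}

theorem minimalIdeal_L_le_iff {x y : minimalIdeal c hc} :
    Green.L.le x y ↔ (x : S) = y ∨ ∃ s ∈ jClassSet c, (x : S) = s * y := by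
  rw [Green.L_le_iff]
  refine or_congr Subtype.ext_iff ⟨fun ⟨s, h⟩ => ⟨s, s.2, congrArg Subtype.val h⟩,
    fun ⟨s, hs, h⟩ => ⟨⟨s, hs⟩, Subtype.ext h⟩⟩

theorem minimalIdeal_R_le_iff {x y : minimalIdeal c hc} :
    Green.R.le x y ↔ (x : S) = y ∨ ∃ s ∈ jClassSet c, (x : S) = y * s := by
  rw [Green.R_le_iff]
  refine or_congr Subtype.ext_iff ⟨fun ⟨s, h⟩ => ⟨s, s.2, congrArg Subtype.val h⟩,
    fun ⟨s, hs, h⟩ => ⟨⟨s, hs⟩, Subtype.ext h⟩⟩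

end Minimal

section NonMinimal

variable (hc : ¬ IsMin c)

/-- An element of a nonminimal `J`-class, as a nonzero element of the principal factor. -/
noncomputable def toRees (x : S) (hx : x ∈ jClassSet c) : ReesQuotient (belowIdeal c hc) :=
  ReesQuotient.of ⟨x, mem_principalIdealSet_iff.2 (le_of_eq hx)⟩ (not_not.2 hx)

variable {hc}

theorem toRees_ne_zero {x : S} (hx : x ∈ jClassSet c) : toRees hc x hx ≠ ReesQuotient.zero :=
  fun h => ReesQuotient.noConfusion rfl (heq_of_eq rfl) (heq_of_eq rfl) (heq_of_eq h)

theorem toRees_inj {x y : S} (hx : x ∈ jClassSet c) (hy : y ∈ jClassSet c) :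
    toRees hc x hx = toRees hc y hy ↔ x = y :=
  ⟨fun h => congrArg Subtype.val (ReesQuotient.of.inj h), fun h => by subst h; rfl⟩

theorem exists_toRees_eq {t : ReesQuotient (belowIdeal c hc)} (ht : t ≠ ReesQuotient.zero) :
    ∃ x hx, t = toRees hc x hx := by
  cases t with
  | zero => exact absurd rfl ht
  | of a ha => exact ⟨a, not_not.1 ha, rfl⟩

theorem toRees_mul {x y : S} (hx : x ∈ jClassSet c) (hy : y ∈ jClassSet c)
    (hxy : x * y ∈ jClassSet c) : toRees hc x hx * toRees hc y hy = toRees hc (x * y) hxy :=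
  ReesQuotient.mk_of_notMem (I := belowIdeal c hc) _

theorem mul_mem_of_toRees_mul_ne_zero {x y : S} (hx : x ∈ jClassSet c) (hy : y ∈ jClassSet c)
    (h : toRees hc x hx * toRees hc y hy ≠ ReesQuotient.zero) : x * y ∈ jClassSet c := by
  by_contra hxy
  exact h (ReesQuotient.mk_of_mem (I := belowIdeal c hc) hxy)

theorem mul_eq_toRees_iff {x y z : S} (hx : x ∈ jClassSet c) (hy : y ∈ jClassSet c)
    (hz : z ∈ jClassSet c) : toRees hc x hx * toRees hc y hy = toRees hc z hz ↔ x * y = z := by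
  constructor
  · intro h
    have hxy := mul_mem_of_toRees_mul_ne_zero hx hy (h ▸ toRees_ne_zero hz)
    rwa [toRees_mul hx hy hxy, toRees_inj] at h
  · rintro rfl
    exact toRees_mul hx hy hz

/-- A zero multiplier cannot give a nonzero product, so only multipliers from `J` matter. -/
theorem toRees_L_le_iff {x y : S} (hx : x ∈ jClassSet c) (hy : y ∈ jClassSet c) :
    Green.L.le (toRees hc x hx) (toRees hc y hy) ↔ x = y ∨ ∃ s ∈ jClassSet c, x = s * y := by
  rw [Green.L_le_iff, toRees_inj]
  refine or_congr Iff.rfl ⟨?_, fun ⟨s, hs, h⟩ =>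
    ⟨toRees hc s hs, ((mul_eq_toRees_iff hs hy hx).2 h.symm).symm⟩⟩
  rintro ⟨s, h⟩
  obtain ⟨s, hs, rfl⟩ := exists_toRees_eq (t := s)
    fun h0 => toRees_ne_zero hx (by rw [h, h0, ReesQuotient.zero_mul])
  exact ⟨s, hs, ((mul_eq_toRees_iff hs hy hx).1 h.symm).symm⟩

theorem toRees_R_le_iff {x y : S} (hx : x ∈ jClassSet c) (hy : y ∈ jClassSet c) :
    Green.R.le (toRees hc x hx) (toRees hc y hy) ↔ x = y ∨ ∃ s ∈ jClassSet c, x = y * s := by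
  rw [Green.R_le_iff, toRees_inj]
  refine or_congr Iff.rfl ⟨?_, fun ⟨s, hs, h⟩ =>
    ⟨toRees hc s hs, ((mul_eq_toRees_iff hy hs hx).2 h.symm).symm⟩⟩
  rintro ⟨s, h⟩
  obtain ⟨s, hs, rfl⟩ := exists_toRees_eq (t := s)
    fun h0 => toRees_ne_zero hx (by rw [h, h0, ReesQuotient.mul_zero])
  exact ⟨s, hs, ((mul_eq_toRees_iff hy hs hx).1 h.symm).symm⟩

theorem isZeroElement_zero :
    IsZeroElement (ReesQuotient.zero : ReesQuotient (belowIdeal c hc)) :=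
  fun a => ⟨ReesQuotient.zero_mul a, ReesQuotient.mul_zero a⟩

end NonMinimal

theorem IsZeroElement.eq {z w : S} (hz : IsZeroElement z) (hw : IsZeroElement w) : z = w :=
  (hz w).1.symm.trans (hw z).2

theorem IsZeroElement.le {z : S} (hz : IsZeroElement z) (k : Green) (x : S) : k.le z x := by
  have hL : Green.L.le z x := Green.L_le_iff.2 (Or.inr ⟨z, (hz x).1.symm⟩)
  have hR : Green.R.le z x := Green.R_le_iff.2 (Or.inr ⟨z, (hz x).2.symm⟩)
  cases k with
  | L => exact hL
  | R => exact hR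
  | J => exact Green.J_le_of_L hL
  | H => exact Green.H_le_iff.2 ⟨hL, hR⟩

theorem IsZeroElement.eq_of_J_le {z x : S} (hz : IsZeroElement z) (h : Green.J.le x z) :
    x = z := by
  obtain ⟨m, hm, hx⟩ := Green.exists_L_le_R_le h
  have : m = z := by
    obtain rfl | ⟨s, rfl⟩ := Green.L_le_iff.1 hm
    · rfl
    · exact (hz s).2
  subst this
  obtain rfl | ⟨s, rfl⟩ := Green.R_le_iff.1 hx
  · rfl
  · exact (hz s).1

theorem mul_mem_jClassSet_of_isMin (hc : IsMin c) {x y : S} (hx : x ∈ jClassSet c)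
    (hy : y ∈ jClassSet c) : x * y ∈ jClassSet c :=
  (minimalIdeal c hc).mul_mem hx hy

theorem not_isSimpleSemigroup_reesQuotient (hc : ¬ IsMin c) :
    ¬ IsSimpleSemigroup (ReesQuotient (belowIdeal c hc)) := by
  rintro ⟨-, h⟩
  obtain ⟨x, hx⟩ := Green.J.exists_classOf_eq c
  exact toRees_ne_zero (hc := hc) hx (isZeroElement_zero.eq_of_J_le (h _ ReesQuotient.zero).1)

/-- A zero `z` of a minimal `J`-class is a zero of `S`, since `z s` and `s z` stay in the class. The
class is then `{z}`, which leaves no product different from `z`. -/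
theorem not_isZeroSimple_minimalIdeal (hc : IsMin c) : ¬ IsZeroSimple (minimalIdeal c hc) := by
  rintro ⟨z, hz, ⟨a, b, hab⟩, -⟩
  have hzS : ∀ s : S, (z : S) * s = z ∧ s * (z : S) = z := by
    intro s
    have h1 : (z : S) * s ∈ jClassSet c :=
      hc.eq_of_le ((classOf_mul_le_left _ _).trans_eq z.2)
    have h2 : s * (z : S) ∈ jClassSet c :=
      hc.eq_of_le ((classOf_mul_le_right _ _).trans_eq z.2)
    have hzz : (z : S) * z = z := congrArg Subtype.val (hz z).1
    have h3 : (z : S) * (z * s) = z := congrArg Subtype.val (hz ⟨_, h1⟩).1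
    have h4 : s * z * (z : S) = z := congrArg Subtype.val (hz ⟨_, h2⟩).2
    rw [← mul_assoc, hzz] at h3
    rw [mul_assoc, hzz] at h4
    exact ⟨h3, h4⟩
  exact hab (Subtype.ext (IsZeroElement.eq_of_J_le hzS (rel_of_mem_jClassSet (a * b).2 z.2).1))

theorem exists_mul_mem_of_semisimple
    (h : IsSimpleSemigroup (principalFactor c) ∨ IsZeroSimple (principalFactor c)) :
    ∃ x y, x ∈ jClassSet c ∧ y ∈ jClassSet c ∧ x * y ∈ jClassSet c := by
  by_cases hc : IsMin c
  · obtain ⟨x, hx⟩ := Green.J.exists_classOf_eq c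
    exact ⟨x, x, hx, hx, mul_mem_jClassSet_of_isMin hc hx hx⟩
  · rw [show principalFactor c = Semigrp.of (ReesQuotient (belowIdeal c hc)) from dif_neg hc] at h
    obtain h | ⟨z, hz, ⟨a, b, hab⟩, -⟩ := h
    · exact absurd h (not_isSimpleSemigroup_reesQuotient hc)
    rw [hz.eq isZeroElement_zero] at hab
    obtain ⟨x, hx, rfl⟩ := exists_toRees_eq (t := a)
      fun h0 => hab (by rw [h0]; exact ReesQuotient.zero_mul b)
    obtain ⟨y, hy, rfl⟩ := exists_toRees_eq (t := b)
      fun h0 => hab (by rw [h0]; exact ReesQuotient.mul_zero _)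
    exact ⟨x, y, hx, hy, mul_mem_of_toRees_mul_ne_zero hx hy hab⟩

/-- Extracts from both kinds of factor the one form of minimality, stated in `S`, that stability
needs. -/
theorem exists_L_minimal_of_completelySemisimple
    (h : IsCompletelySimple (principalFactor c) ∨ IsCompletelyZeroSimple (principalFactor c)) :
    ∃ m ∈ jClassSet c, ∀ s ∈ jClassSet c, s * m ∈ jClassSet c → Green.L.le m (s * m) := by
  by_cases hc : IsMin c
  · rw [show principalFactor c = Semigrp.of (minimalIdeal c hc) from dif_pos hc] at h
    obtain ⟨-, ⟨d, hd⟩, -⟩ | ⟨z, hz, -⟩ := h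
    · obtain ⟨m, rfl⟩ := Green.exists_classOf_eq _ d
      refine ⟨(m : minimalIdeal c hc).1, m.2, fun s hs _ => ?_⟩
      obtain h1 | ⟨t, -, h1⟩ := minimalIdeal_L_le_iff.1 (hd ((Green.classOf_le_classOf _).2
        (Green.L_le_mul (⟨s, hs⟩ : minimalIdeal c hc) m)))
      · exact Green.L_le_iff.2 (Or.inl h1)
      · exact Green.L_le_iff.2 (Or.inr ⟨t, h1⟩)
    · exact absurd ⟨z, hz⟩ (not_isZeroSimple_minimalIdeal hc)
  · rw [show principalFactor c = Semigrp.of (ReesQuotient (belowIdeal c hc)) from dif_neg hc] at h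
    obtain ⟨h, -⟩ | ⟨z, ⟨hz, -⟩, ⟨d, hd⟩, -⟩ := h
    · exact absurd h (not_isSimpleSemigroup_reesQuotient hc)
    obtain rfl := hz.eq isZeroElement_zero
    obtain ⟨t, rfl⟩ := Green.exists_classOf_eq _ d
    obtain ⟨m, hm, rfl⟩ := exists_toRees_eq (t := t) fun h0 =>
      ((hd _).2 rfl).ne (by rw [h0])
    refine ⟨m, hm, fun s hs hsm => ?_⟩
    have hle : Green.L.le (toRees hc _ hsm) (toRees hc m hm) :=
      (toRees_L_le_iff hsm hm).2 (Or.inr ⟨s, hs, rfl⟩)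
    obtain hlt | heq := ((Green.classOf_le_classOf _).2 hle).lt_or_eq
    · exact absurd (hz.eq_of_J_le (Green.J_le_of_L
        ((Green.classOf_eq_classOf _).1 ((hd _).1 hlt)).1)) (toRees_ne_zero hsm)
    · obtain h1 | ⟨u, -, h1⟩ :=
        (toRees_L_le_iff hm hsm).1 ((Green.classOf_eq_classOf _).1 heq).2
      · exact Green.L_le_iff.2 (Or.inl h1)
      · exact Green.L_le_iff.2 (Or.inr ⟨u, h1⟩)

theorem exists_R_minimal_of_completelySemisimple
    (h : IsCompletelySimple (principalFactor c) ∨ IsCompletelyZeroSimple (principalFactor c)) :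
    ∃ m ∈ jClassSet c, ∀ s ∈ jClassSet c, m * s ∈ jClassSet c → Green.R.le m (m * s) := by
  by_cases hc : IsMin c
  · rw [show principalFactor c = Semigrp.of (minimalIdeal c hc) from dif_pos hc] at h
    obtain ⟨-, -, ⟨d, hd⟩⟩ | ⟨z, hz, -⟩ := h
    · obtain ⟨m, rfl⟩ := Green.exists_classOf_eq _ d
      refine ⟨(m : minimalIdeal c hc).1, m.2, fun s hs _ => ?_⟩
      obtain h1 | ⟨t, -, h1⟩ := minimalIdeal_R_le_iff.1 (hd ((Green.classOf_le_classOf _).2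
        (Green.R_le_mul m (⟨s, hs⟩ : minimalIdeal c hc))))
      · exact Green.R_le_iff.2 (Or.inl h1)
      · exact Green.R_le_iff.2 (Or.inr ⟨t, h1⟩)
    · exact absurd ⟨z, hz⟩ (not_isZeroSimple_minimalIdeal hc)
  · rw [show principalFactor c = Semigrp.of (ReesQuotient (belowIdeal c hc)) from dif_neg hc] at h
    obtain ⟨h, -⟩ | ⟨z, ⟨hz, -⟩, -, ⟨d, hd⟩⟩ := h
    · exact absurd h (not_isSimpleSemigroup_reesQuotient hc)
    obtain rfl := hz.eq isZeroElement_zero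
    obtain ⟨t, rfl⟩ := Green.exists_classOf_eq _ d
    obtain ⟨m, hm, rfl⟩ := exists_toRees_eq (t := t) fun h0 =>
      ((hd _).2 rfl).ne (by rw [h0])
    refine ⟨m, hm, fun s hs hsm => ?_⟩
    have hle : Green.R.le (toRees hc _ hsm) (toRees hc m hm) :=
      (toRees_R_le_iff hsm hm).2 (Or.inr ⟨s, hs, rfl⟩)
    obtain hlt | heq := ((Green.classOf_le_classOf _).2 hle).lt_or_eq
    · exact absurd (hz.eq_of_J_le (Green.J_le_of_R
        ((Green.classOf_eq_classOf _).1 ((hd _).1 hlt)).1)) (toRees_ne_zero hsm)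
    · obtain h1 | ⟨u, -, h1⟩ :=
        (toRees_R_le_iff hm hsm).1 ((Green.classOf_eq_classOf _).1 heq).2
      · exact Green.R_le_iff.2 (Or.inl h1)
      · exact Green.R_le_iff.2 (Or.inr ⟨u, h1⟩)

theorem IsCompletelySemisimple.isSemisimpleSemigroup (h : IsCompletelySemisimple S) :
    IsSemisimpleSemigroup S :=
  fun c => (h c).imp (fun h => h.1) fun ⟨z, hz⟩ => ⟨z, hz.1⟩

/-! ### Factorizations in semisimple semigroups -/

namespace IsSemisimpleSemigroup

/-- One product `x y ∈ J` suffices: `a = s x y t` with `s, t ∈ S¹`, and the factors `s x` and `y t`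
lie between `a` and `J`, hence in `J`. -/
theorem exists_eq_mul (h : IsSemisimpleSemigroup S) {a : S} (ha : a ∈ jClassSet c) :
    ∃ x ∈ jClassSet c, ∃ y ∈ jClassSet c, a = x * y := by
  obtain ⟨x, y, hx, hy, hxy⟩ := exists_mul_mem_of_semisimple (h c)
  obtain ⟨m, hm, ham⟩ := Green.exists_L_le_R_le (rel_of_mem_jClassSet ha hxy).1
  obtain ⟨x', rfl, hx'⟩ := Green.exists_eq_mul_of_L_le_mul hm
  obtain ⟨y', rfl, hy'⟩ := Green.exists_eq_mul_of_R_le_mul ham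
  exact ⟨x', mem_jClassSet_of_le ha hx (Green.J_le_mul_left _ _) (Green.J_le_of_L hx'),
    y', mem_jClassSet_of_le ha hy (Green.J_le_mul_right _ _) (Green.J_le_of_R hy'), rfl⟩

theorem exists_mul_mul_eq (h : IsSemisimpleSemigroup S) {a m : S} (ha : a ∈ jClassSet c)
    (hm : m ∈ jClassSet c) : ∃ x ∈ jClassSet c, ∃ y ∈ jClassSet c, a = x * m * y := by
  obtain ⟨x, hx, d, hd, rfl⟩ := h.exists_eq_mul ha
  obtain ⟨b, hb, y, hy, rfl⟩ := h.exists_eq_mul hd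
  obtain ⟨x', y', hx', hy', he⟩ := Green.exists_mul_mul_eq (rel_of_mem_jClassSet hb hm).1 x y
  rw [← mul_assoc, he] at ha ⊢
  exact ⟨x', mem_jClassSet_of_le ha hx
      (Green.J.le_trans (Green.J_le_mul_left _ _) (Green.J_le_mul_left _ _)) (Green.J_le_of_R hx'),
    y', mem_jClassSet_of_le ha hy (Green.J_le_mul_right _ _) (Green.J_le_of_L hy'), rfl⟩

theorem isRegularSemigroup (h : IsSemisimpleSemigroup S) (hs : IsStable S) :
    IsRegularSemigroup S := by
  suffices ∀ a : S, ∃ w, a = a * w * a by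
    intro a
    obtain ⟨w, hw⟩ := this a
    refine ⟨w * a * w, ?_, ?_⟩
    · calc a = a * w * a * w * a := by rw [← hw, ← hw]
        _ = _ := by simp only [mul_assoc]
    · calc w * a * w = w * (a * w * a * w * a) * w := by rw [← hw, ← hw]
        _ = _ := by simp only [mul_assoc]
  intro a
  obtain ⟨b, hb, d, hd, hbd⟩ := h.exists_eq_mul (c := Green.J.classOf a) (a := a) rfl
  have hba : Green.R.le b a := isRightStable_iff.1 hs.2 a b
    (hbd ▸ Green.R_le_mul b d) (rel_of_mem_jClassSet rfl hb)
  have hda : Green.L.le d a := isLeftStable_iff.1 hs.1 a d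
    (hbd ▸ Green.L_le_mul b d) (rel_of_mem_jClassSet rfl hd)
  -- With `b = a u` and `d = v a`, `a = a (u v) a`; the other cases have `u` or `v` equal to the
  -- adjoined identity.
  obtain rfl | ⟨u, rfl⟩ := Green.R_le_iff.1 hba <;> obtain rfl | ⟨v, rfl⟩ := Green.L_le_iff.1 hda
  · exact ⟨d, by rw [← hbd, ← hbd]⟩
  · exact ⟨v, by rw [mul_assoc, ← hbd]⟩
  · exact ⟨u, hbd⟩
  · exact ⟨u * v, by rw [← mul_assoc, mul_assoc, ← hbd]⟩

end IsSemisimpleSemigroup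

/-! ### Complete semisimplicity implies stability -/

namespace IsCompletelySemisimple

/-- Write `b = p m q` with `m` minimal and `a = s b`. Minimality gives `m ≤ s p m` in the `L`-order,
hence `p m ≤ s p m`, and right multiplication by `q` gives `b ≤ a`. -/
theorem isLeftStable (h : IsCompletelySemisimple S) : IsLeftStable S := by
  refine isLeftStable_iff.2 fun a b hab hJ => ?_
  have hs := h.isSemisimpleSemigroup
  obtain ⟨m, hm, hmin⟩ := exists_L_minimal_of_completelySemisimple (h (Green.J.classOf a))
  have hb : b ∈ jClassSet (Green.J.classOf a) := (Green.classOf_eq_classOf _).2 ⟨hJ.2, hJ.1⟩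
  obtain ⟨p, hp, q, hq, rfl⟩ := hs.exists_mul_mul_eq hb hm
  have hpm : p * m ∈ jClassSet (Green.J.classOf a) :=
    mem_jClassSet_of_le hb hm (Green.J_le_mul_left _ _) (Green.J_le_mul_right _ _)
  obtain rfl | ⟨s, rfl⟩ := Green.L_le_iff.1 hab
  · exact Green.le_refl _ _
  have hsp : s * p ∈ jClassSet (Green.J.classOf (s * (p * m * q))) := by
    refine mem_jClassSet_of_le (x := s * (p * m * q)) rfl hp ?_ (Green.J_le_mul_right _ _)
    simpa only [mul_assoc] using Green.J_le_mul_left (s * p) (m * q)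
  have hspm : s * p * m ∈ jClassSet (Green.J.classOf (s * (p * m * q))) := by
    refine mem_jClassSet_of_le (x := s * (p * m * q)) rfl hm ?_ (Green.J_le_mul_right _ _)
    simpa only [mul_assoc] using Green.J_le_mul_left (s * p * m) q
  have := Green.L_le_mul_right (Green.L.le_trans (Green.L_le_mul p m) (hmin _ hsp hspm)) q
  simpa only [mul_assoc] using this

theorem isRightStable (h : IsCompletelySemisimple S) : IsRightStable S := by
  refine isRightStable_iff.2 fun a b hab hJ => ?_
  have hs := h.isSemisimpleSemigroup
  obtain ⟨m, hm, hmin⟩ := exists_R_minimal_of_completelySemisimple (h (Green.J.classOf a))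
  have hb : b ∈ jClassSet (Green.J.classOf a) := (Green.classOf_eq_classOf _).2 ⟨hJ.2, hJ.1⟩
  obtain ⟨p, hp, q, hq, rfl⟩ := hs.exists_mul_mul_eq hb hm
  obtain rfl | ⟨s, rfl⟩ := Green.R_le_iff.1 hab
  · exact Green.le_refl _ _
  have hqs : q * s ∈ jClassSet (Green.J.classOf (p * m * q * s)) := by
    refine mem_jClassSet_of_le (x := p * m * q * s) rfl hq ?_ (Green.J_le_mul_left _ _)
    simpa only [mul_assoc] using Green.J_le_mul_right (p * m) (q * s)
  have hmqs : m * (q * s) ∈ jClassSet (Green.J.classOf (p * m * q * s)) := by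
    refine mem_jClassSet_of_le (x := p * m * q * s) rfl hm ?_ (Green.J_le_mul_left _ _)
    simpa only [mul_assoc] using Green.J_le_mul_right p (m * (q * s))
  have := Green.R_le_mul_left (Green.R.le_trans (Green.R_le_mul m q) (hmin _ hqs hmqs)) p
  simpa only [mul_assoc] using this

end IsCompletelySemisimple

/-! ### Regularity and stability imply complete semisimplicity -/

namespace IsRegularSemigroup

theorem exists_mul_mul_eq (h : IsRegularSemigroup S) {x y : S} (hx : x ∈ jClassSet c)
    (hy : y ∈ jClassSet c) : ∃ s ∈ jClassSet c, ∃ t ∈ jClassSet c, x = s * y * t := by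
  obtain ⟨x', hxx, -⟩ := h x
  obtain ⟨s, t, hs, ht, he⟩ :=
    Green.exists_mul_mul_eq (rel_of_mem_jClassSet hx hy).1 (x * x') (x' * x)
  rw [← hxx, ← mul_assoc, ← hxx] at he
  refine ⟨s, mem_jClassSet_of_le hx hx ?_ ?_, t, mem_jClassSet_of_le hx hx ?_ ?_, he⟩
  · conv_lhs => rw [he]
    exact Green.J.le_trans (Green.J_le_mul_left _ _) (Green.J_le_mul_left _ _)
  · exact Green.J.le_trans (Green.J_le_of_R hs) (Green.J_le_mul_left _ _)
  · conv_lhs => rw [he]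
    exact Green.J_le_mul_right _ _
  · exact Green.J.le_trans (Green.J_le_of_L ht) (Green.J_le_mul_right _ _)

/-- If `x = u y`, then `x = x x' x = (x x' u) y`, whose multiplier is in `J`. So `L`-comparisons of
`S` restrict to the principal factor. -/
theorem exists_mul_eq_of_L_le (h : IsRegularSemigroup S) {x y : S} (hx : x ∈ jClassSet c)
    (hxy : Green.L.le x y) : ∃ s ∈ jClassSet c, x = s * y := by
  obtain ⟨x', hxx, -⟩ := h x
  have hm : x * x' ∈ jClassSet c := by
    refine mem_jClassSet_of_le hx hx ?_ (Green.J_le_mul_left _ _)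
    conv_lhs => rw [hxx]
    exact Green.J_le_mul_left _ _
  obtain rfl | ⟨u, rfl⟩ := Green.L_le_iff.1 hxy
  · exact ⟨x * x', hm, hxx⟩
  · refine ⟨u * y * x' * u, mem_jClassSet_of_le hx hm ?_ (Green.J_le_mul_left _ _), ?_⟩
    · conv_lhs => rw [hxx, ← mul_assoc]
      exact Green.J_le_mul_left _ _
    · conv_lhs => rw [hxx, ← mul_assoc]

theorem exists_mul_eq_of_R_le (h : IsRegularSemigroup S) {x y : S} (hx : x ∈ jClassSet c)
    (hxy : Green.R.le x y) : ∃ s ∈ jClassSet c, x = y * s := by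
  obtain ⟨x', hxx, -⟩ := h x
  rw [mul_assoc] at hxx
  have hm : x' * x ∈ jClassSet c := by
    refine mem_jClassSet_of_le hx hx ?_ (Green.J_le_mul_right _ _)
    conv_lhs => rw [hxx]
    exact Green.J_le_mul_right _ _
  obtain rfl | ⟨u, rfl⟩ := Green.R_le_iff.1 hxy
  · exact ⟨x' * x, hm, hxx⟩
  · refine ⟨u * (x' * (y * u)), mem_jClassSet_of_le hx hm ?_ (Green.J_le_mul_right _ _), ?_⟩
    · conv_lhs => rw [hxx, mul_assoc]
      exact Green.J_le_mul_right _ _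
    · conv_lhs => rw [hxx, mul_assoc]

theorem isCompletelySimple_minimalIdeal (h : IsRegularSemigroup S) (hs : IsStable S)
    (hc : IsMin c) : IsCompletelySimple (minimalIdeal c hc) := by
  have hle : ∀ a b : minimalIdeal c hc, Green.J.le a b := by
    intro a b
    obtain ⟨s, hs, t, ht, he⟩ := h.exists_mul_mul_eq a.2 b.2
    rw [show a = ⟨s, hs⟩ * b * ⟨t, ht⟩ from Subtype.ext he]
    exact Green.J.le_trans (Green.J_le_mul_left _ _) (Green.J_le_mul_right _ _)
  obtain ⟨m, hm⟩ := Green.J.exists_classOf_eq c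
  refine ⟨⟨⟨⟨m, hm⟩⟩, fun a b => ⟨hle a b, hle b a⟩⟩,
    ⟨Green.L.classOf ⟨m, hm⟩, ?_⟩, ⟨Green.R.classOf ⟨m, hm⟩, ?_⟩⟩
  · intro d hd
    obtain ⟨x, rfl⟩ := Green.exists_classOf_eq _ d
    have hx : Green.L.le (x : S) m := Green.L_le_iff.2
      ((minimalIdeal_L_le_iff.1 ((Green.classOf_le_classOf _).1 hd)).imp id fun ⟨s, _, h⟩ => ⟨s, h⟩)
    exact (Green.classOf_le_classOf _).2 (minimalIdeal_L_le_iff.2 (Or.inr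
      (h.exists_mul_eq_of_L_le hm
        (isLeftStable_iff.1 hs.1 _ _ hx (rel_of_mem_jClassSet x.2 hm)))))
  · intro d hd
    obtain ⟨x, rfl⟩ := Green.exists_classOf_eq _ d
    have hx : Green.R.le (x : S) m := Green.R_le_iff.2
      ((minimalIdeal_R_le_iff.1 ((Green.classOf_le_classOf _).1 hd)).imp id fun ⟨s, _, h⟩ => ⟨s, h⟩)
    exact (Green.classOf_le_classOf _).2 (minimalIdeal_R_le_iff.2 (Or.inr
      (h.exists_mul_eq_of_R_le hm
        (isRightStable_iff.1 hs.2 _ _ hx (rel_of_mem_jClassSet x.2 hm)))))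

theorem isZeroSimpleWith_reesQuotient (h : IsRegularSemigroup S) (hc : ¬ IsMin c) :
    IsZeroSimpleWith (ReesQuotient (belowIdeal c hc)) ReesQuotient.zero := by
  refine ⟨isZeroElement_zero, ?_, ?_⟩
  · obtain ⟨x, hx⟩ := Green.J.exists_classOf_eq c
    obtain ⟨s, hs, hsx⟩ := h.exists_mul_eq_of_L_le (c := c) hx (Green.le_refl _ x)
    have hsx' : s * x ∈ jClassSet c := hsx ▸ hx
    exact ⟨toRees hc s hs, toRees hc x hx, toRees_mul hs hx hsx' ▸ toRees_ne_zero hsx'⟩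
  · have hle : ∀ a b : ReesQuotient (belowIdeal c hc), b ≠ ReesQuotient.zero →
        Green.J.le a b := by
      intro a b hb
      by_cases ha : a = ReesQuotient.zero
      · rw [ha]
        exact isZeroElement_zero.le _ _
      obtain ⟨x, hx, rfl⟩ := exists_toRees_eq ha
      obtain ⟨y, hy, rfl⟩ := exists_toRees_eq hb
      obtain ⟨s, hs, t, ht, he⟩ := h.exists_mul_mul_eq hx hy
      have hsy : s * y ∈ jClassSet c := by
        refine mem_jClassSet_of_le hx hy ?_ (Green.J_le_mul_right _ _)
        rw [he]
        exact Green.J_le_mul_left _ _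
      rw [← (mul_eq_toRees_iff hsy ht hx).2 he.symm, ← toRees_mul hs hy hsy]
      exact Green.J.le_trans (Green.J_le_mul_left _ _) (Green.J_le_mul_right _ _)
    intro a b
    constructor
    · refine fun hab => ⟨?_, ?_⟩
      · rintro rfl
        exact isZeroElement_zero.eq_of_J_le hab.2
      · rintro rfl
        exact isZeroElement_zero.eq_of_J_le hab.1
    · intro hab
      by_cases ha : a = ReesQuotient.zero
      · rw [ha, hab.1 ha]
        exact Green.rel_refl _ _
      · exact ⟨hle a b fun hb => ha (hab.2 hb), hle b a ha⟩

theorem isCompletelyZeroSimple_reesQuotient (h : IsRegularSemigroup S) (hs : IsStable S)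
    (hc : ¬ IsMin c) : IsCompletelyZeroSimple (ReesQuotient (belowIdeal c hc)) := by
  obtain ⟨m, hm⟩ := Green.J.exists_classOf_eq c
  have hpos : ∀ k : Green, (∀ a b : ReesQuotient (belowIdeal c hc), k.le a b → Green.J.le a b) →
      k.classOf ReesQuotient.zero < k.classOf (toRees hc m hm) := by
    intro k hk
    refine lt_of_le_not_ge ((Green.classOf_le_classOf _).2 (isZeroElement_zero.le _ _)) ?_
    intro hle
    exact toRees_ne_zero hm
      (isZeroElement_zero.eq_of_J_le (hk _ _ ((Green.classOf_le_classOf _).1 hle)))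
  refine ⟨ReesQuotient.zero, h.isZeroSimpleWith_reesQuotient hc,
    ⟨Green.L.classOf (toRees hc m hm), fun d => ⟨fun hd => ?_, ?_⟩⟩,
    ⟨Green.R.classOf (toRees hc m hm), fun d => ⟨fun hd => ?_, ?_⟩⟩⟩
  · obtain ⟨t, rfl⟩ := Green.exists_classOf_eq _ d
    by_contra hne
    obtain ⟨x, hx, rfl⟩ := exists_toRees_eq (t := t) fun h0 => hne (by rw [h0])
    have hxm : Green.L.le x m := Green.L_le_iff.2
      (((toRees_L_le_iff hx hm).1 ((Green.classOf_le_classOf _).1 hd.le)).imp id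
        fun ⟨s, _, h⟩ => ⟨s, h⟩)
    exact hd.not_ge ((Green.classOf_le_classOf _).2 ((toRees_L_le_iff hm hx).2 (Or.inr
      (h.exists_mul_eq_of_L_le hm
        (isLeftStable_iff.1 hs.1 _ _ hxm (rel_of_mem_jClassSet hx hm))))))
  · rintro rfl
    exact hpos _ fun _ _ => Green.J_le_of_L
  · obtain ⟨t, rfl⟩ := Green.exists_classOf_eq _ d
    by_contra hne
    obtain ⟨x, hx, rfl⟩ := exists_toRees_eq (t := t) fun h0 => hne (by rw [h0])
    have hxm : Green.R.le x m := Green.R_le_iff.2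
      (((toRees_R_le_iff hx hm).1 ((Green.classOf_le_classOf _).1 hd.le)).imp id
        fun ⟨s, _, h⟩ => ⟨s, h⟩)
    exact hd.not_ge ((Green.classOf_le_classOf _).2 ((toRees_R_le_iff hm hx).2 (Or.inr
      (h.exists_mul_eq_of_R_le hm
        (isRightStable_iff.1 hs.2 _ _ hxm (rel_of_mem_jClassSet hx hm))))))
  · rintro rfl
    exact hpos _ fun _ _ => Green.J_le_of_R

theorem isCompletelySemisimple (h : IsRegularSemigroup S) (hs : IsStable S) :
    IsCompletelySemisimple S := by
  intro c
  by_cases hc : IsMin c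
  · rw [show principalFactor c = Semigrp.of (minimalIdeal c hc) from dif_pos hc]
    exact Or.inl (h.isCompletelySimple_minimalIdeal hs hc)
  · rw [show principalFactor c = Semigrp.of (ReesQuotient (belowIdeal c hc)) from dif_neg hc]
    exact Or.inr (h.isCompletelyZeroSimple_reesQuotient hs hc)

end IsRegularSemigroup

end PrincipalFactors

theorem proposition6p5 (S : Type u) [Semigroup S] :
    List.TFAE
      [IsRegularSemigroup S ∧ IsStable S,
        IsRegularSemigroup S ∧ (IsLeftStable S ∨ IsRightStable S),
        IsCompletelySemisimple S,
        IsSemisimpleSemigroup S ∧ IsStable S,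
        IsRegularSemigroup S ∧ ¬ ContainsBicyclic S] ∧
    (IsRegularSemigroup S ∧ IsStable S →
      Green.L.height S = Green.R.height S ∧
      Green.R.height S = Green.H.height S ∧
      Green.H.height S = idempotentHeight S ∧
      idempotentHeight S = Green.J.height S) := by
  refine ⟨?_, fun ⟨h, hs⟩ => Green.heights_eq h hs⟩
  tfae_have 1 → 2 := fun ⟨h, hs⟩ => ⟨h, Or.inl hs.1⟩
  tfae_have 2 → 5 := fun ⟨h, hs⟩ => ⟨h, fun hB => hB.not_stable hs⟩
  tfae_have 5 → 1 := fun ⟨h, hB⟩ => ⟨h, h.isLeftStable hB, h.isRightStable hB⟩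
  tfae_have 1 → 3 := fun ⟨h, hs⟩ => h.isCompletelySemisimple hs
  tfae_have 3 → 4 := fun h => ⟨h.isSemisimpleSemigroup, h.isLeftStable, h.isRightStable⟩
  tfae_have 4 → 1 := fun ⟨h, hs⟩ => ⟨h.isRegularSemigroup hs, hs⟩
  tfae_finish
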